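/- Let $N\ge 0$ be an integer and $r>0$. Write $W^N_{c,+}=\{x\in\mathbb R^N: 0\le x_1\le\cdots\le x_N\}$, $\mathring W^N_{c,+}=\{x\in\mathbb R^N: 0\le x_1<\cdots<x_N\}$, $W^N_{d,+}=\{y\in\mathbb Z_{\ge0}^N: y_1<\cdots<y_N\}$ and $\Delta_N(x)=\prod_{i<j}(x_j-x_i)$. Let $\mathbb Y$ be the set of all Young diagrams (partitions) and $\mathbb Y(N)$ the set of those with at most $N$ rows. The map $\lambda\mapsto(\lambda_N,\lambda_{N-1}+1,\dots,\lambda_1+N-1)$ is a bijection $\mathbb Y(N)\to W^N_{d,+}$. For $x\in\mathring W^N_{c,+}$ and $y\in W^N_{d,+}$ put $$\Lambda_N(x,y)=\frac{\Delta_N(y)}{\Delta_N(x)}\det\Big(\frac{x_i^{y_j}e^{-x_i}}{y_j!}\Big)_{i,j=1}^N,$$ extend $\Lambda_N(\cdot,y)$ by continuity to $W^N_{c,+}$, and let $\Lambda_{N,r}(x,y)=\Lambda_N(rx,y)$. The Thoma cone $\tilde\Omega$ is the set of triples $\omega=(\alpha,\beta,\delta)$ with $\alpha_1\ge\alpha_2\ge\cdots\ge0$,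 $\beta_1\ge\beta_2\ge\cdots\ge0$ and $\sum_i\alpha_i+\sum_i\beta_i\le\delta$. For $\lambda\in\mathbb Y$ let $\dim\lambda$ be the number of paths from $\emptyset$ to $\lambda$ in the Young graph (each step adds one box), and let $s_\lambda(\omega)$ be the Schur function $s_\lambda=\det(h_{\lambda_i-i+j})_{i,j=1}^{\ell(\lambda)}$ specialized at $\omega$, that is, under $p_1\mapsto\delta$ and $p_k\mapsto\sum_i\alpha_i^k+(-1)^{k-1}\sum_i\beta_i^k$ for $k\ge2$, where $h_m=0$ for $m<0$, $h_0=1$ and $n h_n=\sum_{k=1}^n p_kh_{n-k}$. The boundary kernel of the Young bouquet at level $r$ is $$\Lambda^\infty_r(\omega,\lambda)=e^{-r\delta}\,r^{|\lambda|}\,\frac{\dim\lambda}{|\lambda|!}\,s_\lambda(\omega),\qquad \omega\in\tilde\Omega,\ \lambda\in\mathbb Y.$$ For $x\in W^N_{c,+}$ let $\omega_x\in\tilde\Omega$ be the point with $\alpha=(x_N,x_{N-1},\dots,x_1,0,0,\dots)$, $\beta=0$ and $\delta=\sum_{i=1}^Nx_i$. Then, for every $x\in W^N_{c,+}$: 1.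 the continuous extension defining $\Lambda_{N,r}(x,\cdot)$ exists, and both $\Lambda_{N,r}(x,\cdot)$ on $W^N_{d,+}$ and $\Lambda^\infty_r(\omega_x,\cdot)$ on $\mathbb Y$ are non-negative and define probability measures; 2. $\Lambda^\infty_r(\omega_x,\cdot)$ is supported on $\mathbb Y(N)$; 3. under the bijection $\mathbb Y(N)\to W^N_{d,+}$ the probability measures $\Lambda^\infty_r(\omega_x,\cdot)$ and $\Lambda_{N,r}(x,\cdot)$ coincide. -/

import Mathlib

open Filter Topology MeasureTheory

noncomputable section

namespace YoungBouquet

/-! ### The Weyl chambers -/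

/-- The chamber `{x ∈ ℝ₊^N : x₁ ≤ x₂ ≤ ⋯ ≤ x_N}`. -/
def contChamber (N : ℕ) : Set (Fin N → ℝ) :=
  {x | (∀ i, 0 ≤ x i) ∧ Monotone x}

/-- The part of the chamber where no two coordinates coincide, `0 ≤ x₁ < x₂ < ⋯ < x_N`. -/
def contChamberInterior (N : ℕ) : Set (Fin N → ℝ) :=
  {x | (∀ i, 0 ≤ x i) ∧ StrictMono x}

/-- The discrete chamber `{y ∈ ℤ₊^N : y₁ < y₂ < ⋯ < y_N}`. -/
abbrev DiscreteChamber (N : ℕ) : Type :=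
  {y : Fin N → ℕ // StrictMono y}

/-! ### Young diagrams with at most `N` rows -/

instance instMeasurableSpaceYoungDiagram : MeasurableSpace YoungDiagram := ⊤

/-- The set of Young diagrams with at most `N` rows. -/
def atMostRows (N : ℕ) : Set YoungDiagram :=
  {ν | ν.colLen 0 ≤ N}

/-- The map `(λ₁, …, λ_N) ↦ (λ_N, λ_{N-1} + 1, …, λ₂ + N - 2, λ₁ + N - 1)`. -/
def toDiscreteChamber (N : ℕ) (ν : YoungDiagram) : DiscreteChamber N :=
  ⟨fun i => ν.rowLen (Fin.rev i : ℕ) + i, by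
    intro i j hij
    have h1 : (Fin.rev j : ℕ) ≤ (Fin.rev i : ℕ) := by
      simp only [Fin.val_rev]
      have : (i : ℕ) < j := hij
      omega
    have h2 := ν.rowLen_anti _ _ h1
    have h3 : (i : ℕ) < j := hij
    show ν.rowLen _ + (i : ℕ) < ν.rowLen _ + (j : ℕ)
    omega⟩

theorem rowLen_eq_zero_of_mem {N : ℕ} {ν : YoungDiagram} (h : ν ∈ atMostRows N) {k : ℕ}
    (hk : N ≤ k) : ν.rowLen k = 0 := by
  by_contra hne
  have h1 : (k, 0) ∈ ν := YoungDiagram.mem_iff_lt_rowLen.2 (Nat.pos_of_ne_zero hne)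
  have h2 := YoungDiagram.mem_iff_lt_colLen.1 h1
  have h3 : ν.colLen 0 ≤ N := h
  omega

theorem strictMono_sub_le {N : ℕ} (y : DiscreteChamber N) (i j : Fin N) (hij : i ≤ j) :
    y.1 i - i ≤ y.1 j - j := by
  have key : ∀ d : ℕ, ∀ i j : Fin N, (j : ℕ) = i + d → y.1 i + d ≤ y.1 j := by
    intro d
    induction d with
    | zero =>
      intro i j h
      have : i = j := Fin.ext (by omega)
      simp [this]
    | succ d ih =>
      intro i j h
      have hlt : (i : ℕ) + d < N := by have := j.2; omega
      have h1 := ih i ⟨i + d, hlt⟩ rfl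
      have h2 : y.1 ⟨i + d, hlt⟩ < y.1 j := y.2 (by
        show (i : ℕ) + d < j
        omega)
      omega
  have hij' : (i : ℕ) ≤ j := hij
  have := key (j - i) i j (by omega)
  omega

theorem le_strictMono {N : ℕ} (y : DiscreteChamber N) (i : Fin N) : (i : ℕ) ≤ y.1 i := by
  obtain ⟨i, hi⟩ := i
  induction i with
  | zero => simp
  | succ k ih =>
    have h1 := ih (by omega)
    have h2 : y.1 ⟨k, by omega⟩ < y.1 ⟨k + 1, hi⟩ := y.2 (by simp [Fin.lt_def])
    simp only at h1 ⊢
    omega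

theorem toDiscreteChamber_bijective (N : ℕ) :
    Function.Bijective fun ν : atMostRows N => toDiscreteChamber N ν.1 := by
  constructor
  · rintro ⟨μ, hμ⟩ ⟨ν, hν⟩ h
    apply Subtype.ext
    have hrow : ∀ k, μ.rowLen k = ν.rowLen k := by
      intro k
      by_cases hk : k < N
      · have h1 := congrFun (congrArg Subtype.val h) (Fin.rev ⟨k, hk⟩)
        have h2 : μ.rowLen (Fin.rev (Fin.rev (⟨k, hk⟩ : Fin N)) : ℕ) =
            ν.rowLen (Fin.rev (Fin.rev (⟨k, hk⟩ : Fin N)) : ℕ) := Nat.add_right_cancel h1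
        simpa only [Fin.rev_rev] using h2
      · rw [rowLen_eq_zero_of_mem hμ (by omega), rowLen_eq_zero_of_mem hν (by omega)]
    apply YoungDiagram.ext
    ext ⟨a, b⟩
    rw [YoungDiagram.mem_cells, YoungDiagram.mem_cells, YoungDiagram.mem_iff_lt_rowLen,
      YoungDiagram.mem_iff_lt_rowLen, hrow]
  · intro y
    let w : List ℕ := List.ofFn fun k : Fin N => y.1 (Fin.rev k) - (Fin.rev k : ℕ)
    have hw : w.SortedGE := by
      rw [List.sortedGE_ofFn_iff]
      intro a b hab
      exact strictMono_sub_le y _ _ (Fin.rev_le_rev.2 hab)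
    have hlen : w.length = N := by simp [w]
    have hmem : YoungDiagram.ofRowLens w hw ∈ atMostRows N := by
      show (YoungDiagram.ofRowLens w hw).colLen 0 ≤ N
      by_contra hlt
      have h1 : (N, 0) ∈ YoungDiagram.ofRowLens w hw :=
        YoungDiagram.mem_iff_lt_colLen.2 (by omega)
      rw [YoungDiagram.mem_ofRowLens] at h1
      obtain ⟨h2, -⟩ := h1
      simp only at h2
      omega
    refine ⟨⟨_, hmem⟩, ?_⟩
    apply Subtype.ext
    funext i
    have h1 := YoungDiagram.rowLen_ofRowLens (hw := hw)
      (⟨(Fin.rev i : ℕ), by rw [hlen]; exact (Fin.rev i).2⟩ : Fin w.length)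
    show (YoungDiagram.ofRowLens w hw).rowLen (Fin.rev i : ℕ) + (i : ℕ) = y.1 i
    have h2 := le_strictMono y i
    rw [h1]
    simp only [w, List.getElem_ofFn, Fin.getElem_fin, Fin.eta, Fin.rev_rev]
    omega

/-- The bijection between Young diagrams with at most `N` rows and the discrete chamber. -/
def chamberEquiv (N : ℕ) : atMostRows N ≃ DiscreteChamber N :=
  Equiv.ofBijective _ (toDiscreteChamber_bijective N)

/-! ### The Young graph -/

/-- `μ` and `ν` are joined by an edge of the Young graph: `ν` is `μ` plus one box. -/
def Edge (μ ν : YoungDiagram) : Prop :=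
  μ ≤ ν ∧ ν.card = μ.card + 1

/-- The number of paths in the Young graph from the empty diagram to `ν`. -/
def dim (ν : YoungDiagram) : ℕ :=
  Nat.card {p : Fin (ν.card + 1) → YoungDiagram //
    p 0 = ⊥ ∧ p (Fin.last ν.card) = ν ∧ ∀ i : Fin ν.card, Edge (p i.castSucc) (p i.succ)}

/-! ### The Thoma cone and the extended Schur functions -/

/-- The Thoma cone: triples `(α, β, δ)` with `α₁ ≥ α₂ ≥ ⋯ ≥ 0`, `β₁ ≥ β₂ ≥ ⋯ ≥ 0` and
`∑ αᵢ + ∑ βᵢ ≤ δ`. -/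
structure ThomaCone where
  α : ℕ → ℝ
  β : ℕ → ℝ
  δ : ℝ
  α_nonneg : ∀ i, 0 ≤ α i
  β_nonneg : ∀ i, 0 ≤ β i
  α_antitone : Antitone α
  β_antitone : Antitone β
  α_summable : Summable α
  β_summable : Summable β
  sum_le : (∑' i, α i) + (∑' i, β i) ≤ δ

/-- The power sums on the Thoma cone: `p₁(ω) = δ` and
`p_k(ω) = ∑ αᵢ^k + (-1)^(k-1) ∑ βᵢ^k` for `k ≥ 2`. -/
def powerSum (ω : ThomaCone) (k : ℕ) : ℝ :=
  if k = 1 then ω.δ else (∑' i, ω.α i ^ k) + (-1) ^ (k - 1) * ∑' i, ω.β i ^ k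

/-- The complete homogeneous symmetric functions, expressed through the power sums:
`h₀ = 1` and `n hₙ = p₁ hₙ₋₁ + p₂ hₙ₋₂ + ⋯ + pₙ h₀`. -/
def completeHomogeneous (ω : ThomaCone) : ℕ → ℝ
  | 0 => 1
  | n + 1 => (∑ k : Fin (n + 1), powerSum ω (k + 1) * completeHomogeneous ω (n - k)) / (n + 1)
termination_by n => n
decreasing_by omega

/-- `h_m(ω)` for an integer index, with `h_m = 0` for `m < 0`. -/
def completeHomogeneousInt (ω : ThomaCone) (m : ℤ) : ℝ :=
  if m < 0 then 0 else completeHomogeneous ω m.toNat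

/-- The Schur function `s_ν = det (h_{ν_i - i + j})` evaluated at a point of the Thoma cone. -/
def schur (ω : ThomaCone) (ν : YoungDiagram) : ℝ :=
  (Matrix.of fun i j : Fin (ν.colLen 0) =>
    completeHomogeneousInt ω ((ν.rowLen i : ℤ) - (i : ℤ) + (j : ℤ))).det

/-- The weight that the boundary kernel at level `r` gives to a diagram `ν`:
`e^{-rδ} r^{|ν|} (dim ν / |ν|!) s_ν(ω)`. -/
def boundaryWeight (r : ℝ) (ω : ThomaCone) (ν : YoungDiagram) : ℝ :=
  Real.exp (-(r * ω.δ)) * r ^ ν.card * ((dim ν : ℝ) / (ν.card.factorial : ℝ)) * schur ω ν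

/-- The boundary kernel of the Young bouquet, from the Thoma cone to the level `r` of the bouquet
(which is the set of Young diagrams for `r > 0`). -/
def boundaryKernel (r : ℝ) (ω : ThomaCone) : Measure YoungDiagram :=
  Measure.count.withDensity fun ν => ENNReal.ofReal (boundaryWeight r ω ν)

/-! ### The points `ω_x` -/

/-- The sequence `x_N ≥ x_{N-1} ≥ ⋯ ≥ x₁` continued by zeros. -/
def alphaSeq {N : ℕ} (x : Fin N → ℝ) (l : ℕ) : ℝ :=
  if h : l < N then x (Fin.rev ⟨l, h⟩) else 0

theorem hasSum_alphaSeq {N : ℕ} (x : Fin N → ℝ) : HasSum (alphaSeq x) (∑ i, x i) := by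
  have h1 : HasSum (alphaSeq x) (∑ l ∈ Finset.range N, alphaSeq x l) := by
    apply hasSum_sum_of_ne_finset_zero
    intro l hl
    simp only [Finset.mem_range] at hl
    simp [alphaSeq, hl]
  have h2 : ∑ l ∈ Finset.range N, alphaSeq x l = ∑ i, x i := by
    rw [Finset.sum_range]
    rw [← Equiv.sum_comp Fin.revPerm x]
    refine Finset.sum_congr rfl fun i _ => ?_
    simp [alphaSeq]
  rwa [h2] at h1

/-- The point `ω_x = (α, 0, δ)` of the Thoma cone with `α = (x_N, …, x₁, 0, 0, …)` and
`δ = ∑ xᵢ`. -/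
def omegaPoint {N : ℕ} (x : contChamber N) : ThomaCone where
  α := alphaSeq x.1
  β := fun _ => 0
  δ := ∑ i, x.1 i
  α_nonneg := by
    intro l
    unfold alphaSeq
    split_ifs
    · exact x.2.1 _
    · exact le_rfl
  β_nonneg := fun _ => le_rfl
  α_antitone := by
    intro a b hab
    unfold alphaSeq
    split_ifs with hb ha
    · exact x.2.2 (Fin.rev_le_rev.2 hab)
    · omega
    · exact x.2.1 _
    · exact le_rfl
  β_antitone := fun _ _ _ => le_rfl
  α_summable := (hasSum_alphaSeq x.1).summable
  β_summable := summable_zero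
  sum_le := by
    rw [(hasSum_alphaSeq x.1).tsum_eq]
    simp

/-! ### The kernel from the continuous to the discrete chamber -/

/-- `Δ_N(y) / Δ_N(x) · det (x_i^{y_j} e^{-x_i} / y_j!)`, for `x` without coinciding coordinates. -/
def kernelFormula {N : ℕ} (x : Fin N → ℝ) (y : DiscreteChamber N) : ℝ :=
  (Matrix.vandermonde fun j => (y.1 j : ℝ)).det / (Matrix.vandermonde x).det *
    (Matrix.of fun i j : Fin N =>
      x i ^ y.1 j * Real.exp (-x i) / ((y.1 j).factorial : ℝ)).det

/-- `Λ_N(x, y)`: the continuous extension of `kernelFormula` from the interior to the whole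
chamber. -/
def kernelN {N : ℕ} (x : Fin N → ℝ) (y : DiscreteChamber N) : ℝ :=
  extendFrom (contChamberInterior N) (fun z => kernelFormula z y) x

/-- `Λ_{N,σ}(x, y) = Λ_N(σ x, y)`. -/
def kernelScaled {N : ℕ} (σ : ℝ) (x : Fin N → ℝ) (y : DiscreteChamber N) : ℝ :=
  kernelN (σ • x) y

/-- The measure `Λ_{N,σ}(x, ·)` on the discrete chamber. -/
def kernelMeasure {N : ℕ} (σ : ℝ) (x : Fin N → ℝ) : Measure (DiscreteChamber N) :=
  Measure.count.withDensity fun y => ENNReal.ofReal (kernelScaled σ x y)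

end YoungBouquet

end

noncomputable section

namespace YoungBouquet

/-! ### Determinants of shifts of a sequence -/

/-- The determinant `det (f (y_i - k))` with `k = 0, …, N - 1`. -/
def shiftDet {N : ℕ} (f : ℤ → ℝ) (y : Fin N → ℤ) : ℝ :=
  (Matrix.of fun i k : Fin N => f (y i - (k : ℤ))).det

theorem shiftDet_eq_zero_of_not_injective {N : ℕ} (f : ℤ → ℝ) {y : Fin N → ℤ}
    (hy : ¬ Function.Injective y) : shiftDet f y = 0 := by
  simp only [Function.Injective, not_forall] at hy
  obtain ⟨i, j, hij, hne⟩ := hy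
  refine Matrix.det_zero_of_row_eq hne ?_
  ext k
  simp [hij]

theorem shiftDet_eq_zero_of_neg {N : ℕ} {f : ℤ → ℝ} (hf : ∀ m < 0, f m = 0) {y : Fin N → ℤ}
    {i : Fin N} (hy : y i < 0) : shiftDet f y = 0 := by
  refine Matrix.det_eq_zero_of_row_eq_zero i fun k => ?_
  exact hf _ (by omega)

theorem shiftDet_id {N : ℕ} {f : ℤ → ℝ} (hf : ∀ m < 0, f m = 0) (hf0 : f 0 = 1) :
    shiftDet f (fun i : Fin N => ((i : ℕ) : ℤ)) = 1 := by
  rw [shiftDet, Matrix.det_of_isLowerTriangular]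
  · exact Finset.prod_eq_one fun i _ => by simpa using hf0
  · intro i j hij
    have : (i : ℕ) < j := hij
    exact hf _ (by omega)

theorem sum_prod_update {N : ℕ} {A : Fin N → ℝ} {c B : Fin N → ℝ} (h : ∀ i, B i = c i * A i) :
    ∑ i, ∏ l, (if l = i then B l else A l) = (∑ i, c i) * ∏ l, A l := by
  rw [Finset.sum_mul]
  refine Finset.sum_congr rfl fun i _ => ?_
  have : ∀ l, (if l = i then B l else A l) = (if l = i then c l else 1) * A l := by
    intro l
    split_ifs
    · exact h l
    · simp
  simp only [this, Finset.prod_mul_distrib]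
  simp

theorem sum_shiftDet_sub {N : ℕ} {f : ℤ → ℝ} (hf : ∀ m, f (m - 1) = m * f m) (y : Fin N → ℤ) :
    ∑ i, shiftDet f (y - Pi.single i 1) =
      ((∑ i, (y i : ℝ)) - ∑ i : Fin N, ((i : ℕ) : ℝ)) * shiftDet f y := by
  simp only [shiftDet, Matrix.det_apply', Matrix.of_apply]
  rw [Finset.sum_comm, Finset.mul_sum]
  refine Finset.sum_congr rfl fun σ _ => ?_
  rw [← Finset.mul_sum, mul_left_comm]
  congr 1
  have key := sum_prod_update (A := fun l => f (y (σ l) - (l : ℤ)))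
    (B := fun l => f (y (σ l) - 1 - (l : ℤ))) (c := fun l => (y (σ l) : ℝ) - ((l : ℕ) : ℝ))
    (fun l => by
      have := hf (y (σ l) - (l : ℤ))
      push_cast at this
      rw [← this]
      congr 1
      ring)
  rw [Finset.sum_sub_distrib, Equiv.sum_comp σ fun i => (y i : ℝ)] at key
  rw [← key, ← Equiv.sum_comp σ]
  refine Finset.sum_congr rfl fun i _ => Finset.prod_congr rfl fun l _ => ?_
  by_cases h : l = i
  · subst h
    simp
  · simp [h, σ.injective.eq_iff]

theorem shiftDet_zpow_mul {N : ℕ} {f : ℤ → ℝ} {r : ℝ} (hr : r ≠ 0) (y : Fin N → ℤ) :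
    shiftDet (fun m => r ^ m * f m) y = r ^ ((∑ i, y i) - ∑ i : Fin N, (i : ℤ)) * shiftDet f y := by
  have h1 : (Matrix.of fun i k : Fin N => r ^ (y i - (k : ℤ)) * f (y i - (k : ℤ))) =
      Matrix.of fun i k : Fin N => r ^ (y i) *
        (Matrix.of fun i k : Fin N => r ^ (-(k : ℤ)) * f (y i - (k : ℤ))) i k := by
    ext i k
    simp only [Matrix.of_apply]
    rw [← mul_assoc, ← zpow_add₀ hr]
    rfl
  have h2 : ∀ (s : Finset (Fin N)) (z : Fin N → ℤ), ∏ i ∈ s, r ^ z i = r ^ ∑ i ∈ s, z i := by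
    intro s z
    induction s using Finset.cons_induction with
    | empty => simp
    | cons a s ha ih => rw [Finset.prod_cons, Finset.sum_cons, zpow_add₀ hr, ih]
  unfold shiftDet
  rw [h1, Matrix.det_mul_column]
  have h3 := Matrix.det_mul_row (fun k : Fin N => r ^ (-(k : ℤ)))
    (Matrix.of fun i k : Fin N => f (y i - (k : ℤ)))
  simp only [Matrix.of_apply] at h3
  rw [h3, h2, h2, ← mul_assoc, ← zpow_add₀ hr, Finset.sum_neg_distrib, sub_eq_add_neg]

/-- `1 / m!`, continued by zero to the negative integers. -/
def invFactorial (m : ℤ) : ℝ :=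
  if m < 0 then 0 else ((m.toNat.factorial : ℝ))⁻¹

theorem invFactorial_of_neg (m : ℤ) (hm : m < 0) : invFactorial m = 0 := if_pos hm

theorem invFactorial_natCast (n : ℕ) : invFactorial n = ((n.factorial : ℝ))⁻¹ := by
  simp [invFactorial]

theorem invFactorial_zero : invFactorial 0 = 1 := by
  simp [invFactorial]

theorem invFactorial_sub_one (m : ℤ) : invFactorial (m - 1) = m * invFactorial m := by
  rcases lt_trichotomy m 0 with h | h | h
  · rw [invFactorial_of_neg _ h, invFactorial_of_neg _ (by omega), mul_zero]
  · subst h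
    simp [invFactorial]
  · obtain ⟨n, rfl⟩ : ∃ n : ℕ, m = (n : ℤ) + 1 := ⟨(m - 1).toNat, by omega⟩
    have h1 := invFactorial_natCast (n + 1)
    push_cast at h1
    rw [add_sub_cancel_right, invFactorial_natCast, h1, Nat.factorial_succ]
    push_cast
    have : (n.factorial : ℝ) ≠ 0 := by positivity
    have : (n : ℝ) + 1 ≠ 0 := by positivity
    field_simp

theorem invFactorial_sub (n k : ℕ) :
    invFactorial ((n : ℤ) - k) = ((n.factorial : ℝ))⁻¹ * (n.descFactorial k : ℝ) := by
  by_cases h : k ≤ n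
  · rw [← Nat.cast_sub h, invFactorial_natCast, ← Nat.factorial_mul_descFactorial h]
    push_cast
    have : ((n - k).factorial : ℝ) ≠ 0 := by positivity
    have : (n.descFactorial k : ℝ) ≠ 0 := by
      have h2 := Nat.factorial_mul_descFactorial h
      intro h3
      rw [Nat.cast_eq_zero] at h3
      rw [h3, mul_zero] at h2
      exact Nat.factorial_ne_zero n h2.symm
    field_simp
  · rw [invFactorial_of_neg _ (by omega), Nat.descFactorial_of_lt (by omega)]
    simp

theorem shiftDet_invFactorial {N : ℕ} (y : Fin N → ℕ) :
    shiftDet invFactorial (fun i => (y i : ℤ)) =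
      (Matrix.vandermonde fun j => (y j : ℝ)).det / ∏ j, ((y j).factorial : ℝ) := by
  have h1 := Matrix.det_eval_matrixOfPolynomials_eq_det_vandermonde (fun i => (y i : ℝ))
    (fun i => descPochhammer ℝ i) (fun i => descPochhammer_natDegree ℝ i)
    (fun i => monic_descPochhammer ℝ i)
  simp only [descPochhammer_eval_eq_descFactorial] at h1
  have h2 := Matrix.det_mul_column (fun i => (((y i).factorial : ℝ))⁻¹)
    (Matrix.of fun i k : Fin N => ((y i).descFactorial k : ℝ))
  simp only [Matrix.of_apply] at h2
  simp only [shiftDet, invFactorial_sub]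
  rw [h2, h1, Finset.prod_inv_distrib, div_eq_inv_mul]

theorem shiftDet_invFactorial_nonneg {N : ℕ} (y : DiscreteChamber N) :
    0 ≤ shiftDet invFactorial (fun i => (y.1 i : ℤ)) := by
  rw [shiftDet_invFactorial, Matrix.det_vandermonde]
  refine div_nonneg ?_ (by positivity)
  refine Finset.prod_nonneg fun i _ => Finset.prod_nonneg fun j hj => ?_
  have := y.2 (Finset.mem_Ioi.1 hj)
  rw [sub_nonneg]
  exact_mod_cast this.le

/-! ### Complete homogeneous symmetric polynomials in finitely many variables -/

/-- The geometric series `∑ xⁿ tⁿ`. -/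
def geomSeries (x : ℝ) : PowerSeries ℝ := PowerSeries.mk fun n => x ^ n

theorem geomSeries_mul (x : ℝ) :
    geomSeries x * ((1 - Polynomial.C x * Polynomial.X : Polynomial ℝ) : PowerSeries ℝ) = 1 := by
  ext n
  rw [Polynomial.coe_sub, Polynomial.coe_one, Polynomial.coe_mul, Polynomial.coe_C,
    Polynomial.coe_X, mul_sub, mul_one, mul_left_comm, map_sub, PowerSeries.coeff_C_mul]
  cases n with
  | zero => simp [geomSeries]
  | succ n =>
    rw [PowerSeries.coeff_succ_mul_X]
    simp [geomSeries, PowerSeries.coeff_one, pow_succ']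

theorem derivative_geomSeries (x : ℝ) :
    PowerSeries.derivative ℝ (geomSeries x) = PowerSeries.C x * geomSeries x * geomSeries x := by
  ext n
  rw [PowerSeries.coeff_derivative, mul_assoc, PowerSeries.coeff_C_mul, PowerSeries.coeff_mul]
  simp only [geomSeries, PowerSeries.coeff_mk]
  have h : ∀ p ∈ Finset.HasAntidiagonal.antidiagonal n, x ^ p.1 * x ^ p.2 = x ^ n := fun p hp => by
    rw [← pow_add, Finset.HasAntidiagonal.mem_antidiagonal.1 hp]
  rw [Finset.sum_congr rfl h, Finset.sum_const, Finset.Nat.card_antidiagonal, nsmul_eq_mul]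
  push_cast
  ring

/-- The generating series of the complete homogeneous symmetric polynomials at `x`. -/
def homogeneousSeries {N : ℕ} (x : Fin N → ℝ) : PowerSeries ℝ := ∏ i, geomSeries (x i)

/-- The complete homogeneous symmetric polynomial `h_n(x₁, …, x_N)`. -/
def homogeneousSum {N : ℕ} (x : Fin N → ℝ) (n : ℕ) : ℝ :=
  PowerSeries.coeff n (homogeneousSeries x)

/-- `h_m(x₁, …, x_N)` with an integer index, zero for `m < 0`. -/
def homogeneousSumInt {N : ℕ} (x : Fin N → ℝ) (m : ℤ) : ℝ :=
  if m < 0 then 0 else homogeneousSum x m.toNat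

theorem homogeneousSumInt_of_neg {N : ℕ} (x : Fin N → ℝ) (m : ℤ) (hm : m < 0) :
    homogeneousSumInt x m = 0 := if_pos hm

theorem homogeneousSumInt_natCast {N : ℕ} (x : Fin N → ℝ) (n : ℕ) :
    homogeneousSumInt x n = homogeneousSum x n := by
  simp [homogeneousSumInt]

theorem homogeneousSum_eq_sum {N : ℕ} (x : Fin N → ℝ) (n : ℕ) :
    homogeneousSum x n = ∑ l ∈ Finset.univ.finsuppAntidiag n, ∏ i, x i ^ l i := by
  classical
  rw [homogeneousSum, homogeneousSeries, PowerSeries.coeff_prod]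
  simp [geomSeries]

theorem homogeneousSum_zero {N : ℕ} (x : Fin N → ℝ) : homogeneousSum x 0 = 1 := by
  simp [homogeneousSum_eq_sum]

theorem continuous_homogeneousSumInt {N : ℕ} (m : ℤ) :
    Continuous fun x : Fin N → ℝ => homogeneousSumInt x m := by
  unfold homogeneousSumInt
  split_ifs
  · exact continuous_const
  · simp only [homogeneousSum_eq_sum]
    fun_prop

theorem homogeneousSumInt_smul {N : ℕ} (x : Fin N → ℝ) (r : ℝ) (m : ℤ) :
    homogeneousSumInt (r • x) m = r ^ m * homogeneousSumInt x m := by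
  unfold homogeneousSumInt
  split_ifs with hm
  · simp
  · obtain ⟨n, rfl⟩ := Int.eq_ofNat_of_zero_le (not_lt.1 hm)
    simp only [homogeneousSum_eq_sum, Int.toNat_natCast, zpow_natCast]
    rw [Finset.mul_sum]
    refine Finset.sum_congr rfl fun l hl => ?_
    rw [Finset.mem_finsuppAntidiag] at hl
    simp only [Pi.smul_apply, smul_eq_mul, mul_pow, Finset.prod_mul_distrib,
      Finset.prod_pow_eq_pow_sum]
    rw [hl.1]

theorem derivative_homogeneousSeries {N : ℕ} (x : Fin N → ℝ) :
    PowerSeries.derivative ℝ (homogeneousSeries x) =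
      (∑ i, PowerSeries.C (x i) * geomSeries (x i)) * homogeneousSeries x := by
  unfold homogeneousSeries
  induction (Finset.univ : Finset (Fin N)) using Finset.cons_induction with
  | empty => simp
  | cons a s ha ih =>
    rw [Finset.prod_cons, Finset.sum_cons, Derivation.leibniz, ih, derivative_geomSeries]
    simp only [smul_eq_mul]
    ring

theorem homogeneousSum_succ {N : ℕ} (x : Fin N → ℝ) (n : ℕ) :
    homogeneousSum x (n + 1) * (n + 1) =
      ∑ k : Fin (n + 1), (∑ i, x i ^ ((k : ℕ) + 1)) * homogeneousSum x (n - k) := by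
  have h := congrArg (PowerSeries.coeff n) (derivative_homogeneousSeries x)
  rw [PowerSeries.coeff_derivative, PowerSeries.coeff_mul,
    Finset.Nat.sum_antidiagonal_eq_sum_range_succ_mk, Finset.sum_range] at h
  rw [homogeneousSum, h]
  refine Finset.sum_congr rfl fun k _ => ?_
  simp [homogeneousSum, geomSeries, pow_succ']

theorem powerSum_omegaPoint {N : ℕ} (x : contChamber N) (k : ℕ) :
    powerSum (omegaPoint x) (k + 1) = ∑ i, x.1 i ^ (k + 1) := by
  unfold powerSum
  split_ifs with h
  · obtain rfl : k = 0 := by omega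
    simp [omegaPoint]
  · have h1 : (fun l => alphaSeq x.1 l ^ (k + 1)) = alphaSeq fun i => x.1 i ^ (k + 1) := by
      funext l
      unfold alphaSeq
      split_ifs <;> simp
    simp only [omegaPoint, h1, (hasSum_alphaSeq _).tsum_eq]
    simp

theorem completeHomogeneous_omegaPoint {N : ℕ} (x : contChamber N) (n : ℕ) :
    completeHomogeneous (omegaPoint x) n = homogeneousSum x.1 n := by
  induction n using Nat.strong_induction_on with
  | _ n ih =>
    cases n with
    | zero => rw [completeHomogeneous, homogeneousSum_zero]
    | succ n =>
      rw [completeHomogeneous, div_eq_iff (by positivity), homogeneousSum_succ]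
      refine Finset.sum_congr rfl fun k _ => ?_
      rw [ih _ (by omega), powerSum_omegaPoint]

theorem completeHomogeneousInt_omegaPoint {N : ℕ} (x : contChamber N) (m : ℤ) :
    completeHomogeneousInt (omegaPoint x) m = homogeneousSumInt x.1 m := by
  simp only [completeHomogeneousInt, homogeneousSumInt, completeHomogeneous_omegaPoint]

/-! ### The bialternant formula -/

theorem coeff_homogeneousSeries_mul {N M : ℕ} (x : Fin N → ℝ) {q : Polynomial ℝ}
    (hq : q.natDegree < M) (m : ℕ) :
    PowerSeries.coeff m (homogeneousSeries x * (q : PowerSeries ℝ)) =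
      ∑ k : Fin M, homogeneousSumInt x ((m : ℤ) - (k : ℕ)) * q.coeff k := by
  rw [mul_comm, PowerSeries.coeff_mul, Finset.Nat.sum_antidiagonal_eq_sum_range_succ_mk,
    ← Finset.sum_range fun k => homogeneousSumInt x ((m : ℤ) - (k : ℕ)) * q.coeff k]
  have h1 : ∑ k ∈ Finset.range M, homogeneousSumInt x ((m : ℤ) - (k : ℕ)) * q.coeff k =
      ∑ k ∈ Finset.range (M + (m + 1)), homogeneousSumInt x ((m : ℤ) - (k : ℕ)) * q.coeff k := by
    refine Finset.sum_subset (Finset.range_mono (by omega)) fun k _ hk => ?_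
    rw [Finset.mem_range, not_lt] at hk
    rw [Polynomial.coeff_eq_zero_of_natDegree_lt (by omega), mul_zero]
  have h2 : ∑ k ∈ Finset.range (m + 1), homogeneousSumInt x ((m : ℤ) - (k : ℕ)) * q.coeff k =
      ∑ k ∈ Finset.range (M + (m + 1)), homogeneousSumInt x ((m : ℤ) - (k : ℕ)) * q.coeff k := by
    refine Finset.sum_subset (Finset.range_mono (by omega)) fun k _ hk => ?_
    rw [Finset.mem_range, not_lt] at hk
    rw [homogeneousSumInt_of_neg _ _ (by omega), zero_mul]
  rw [h1, ← h2]
  refine Finset.sum_congr rfl fun k hk => ?_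
  rw [Finset.mem_range] at hk
  rw [← Nat.cast_sub (by omega), homogeneousSumInt_natCast, Polynomial.coeff_coe, mul_comm]
  rfl

theorem natDegree_prod_one_sub_le {N : ℕ} (x : Fin N → ℝ) (s : Finset (Fin N)) :
    (∏ i ∈ s, (1 - Polynomial.C (x i) * Polynomial.X)).natDegree ≤ s.card := by
  refine (Polynomial.natDegree_prod_le _ _).trans ?_
  refine (Finset.sum_le_card_nsmul _ _ 1 fun i _ => ?_).trans (by simp)
  compute_degree

theorem homogeneousSeries_mul_prod {N : ℕ} (x : Fin N → ℝ) (s : Finset (Fin N)) :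
    (∏ i ∈ s, geomSeries (x i)) *
      ((∏ i ∈ s, (1 - Polynomial.C (x i) * Polynomial.X) : Polynomial ℝ) : PowerSeries ℝ) = 1 := by
  induction s using Finset.cons_induction with
  | empty => simp
  | cons a s ha ih =>
    rw [Finset.prod_cons, Finset.prod_cons, Polynomial.coe_mul, mul_mul_mul_comm, ih,
      geomSeries_mul, mul_one]

/-- The polynomial `∏_{i ≠ j} (1 - x_i t)`. -/
def omitPoly {N : ℕ} (x : Fin N → ℝ) (j : Fin N) : Polynomial ℝ :=
  ∏ i ∈ Finset.univ.erase j, (1 - Polynomial.C (x i) * Polynomial.X)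

theorem pow_eq_sum_homogeneousSumInt {N : ℕ} (x : Fin N → ℝ) (j : Fin N) (m : ℕ) :
    x j ^ m = ∑ k : Fin N, homogeneousSumInt x ((m : ℤ) - (k : ℕ)) * (omitPoly x j).coeff k := by
  have hdeg : (omitPoly x j).natDegree < N := by
    have h1 := natDegree_prod_one_sub_le x (Finset.univ.erase j)
    rw [Finset.card_erase_of_mem (Finset.mem_univ j), Finset.card_fin] at h1
    have := j.2
    unfold omitPoly
    omega
  rw [← coeff_homogeneousSeries_mul x hdeg, homogeneousSeries,
    ← Finset.mul_prod_erase _ _ (Finset.mem_univ j), mul_assoc, omitPoly,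
    homogeneousSeries_mul_prod, mul_one, geomSeries, PowerSeries.coeff_mk]

/-- The alternant `det (x_k ^ y_i)`. -/
def alternant {N : ℕ} (x : Fin N → ℝ) (y : Fin N → ℕ) : ℝ :=
  (Matrix.of fun i k : Fin N => x k ^ y i).det

theorem alternant_eq_mul_det {N : ℕ} (x : Fin N → ℝ) (y : Fin N → ℕ) :
    alternant x y = shiftDet (homogeneousSumInt x) (fun i => (y i : ℤ)) *
      (Matrix.of fun k j : Fin N => (omitPoly x j).coeff k).det := by
  rw [shiftDet, ← Matrix.det_mul, alternant]
  congr 1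
  ext i j
  rw [Matrix.mul_apply, Matrix.of_apply, pow_eq_sum_homogeneousSumInt]
  rfl

theorem homogeneousSumInt_zero {N : ℕ} (x : Fin N → ℝ) : homogeneousSumInt x 0 = 1 := by
  rw [← homogeneousSum_zero x, ← homogeneousSumInt_natCast, Nat.cast_zero]

theorem alternant_id {N : ℕ} (x : Fin N → ℝ) :
    alternant x (fun i => (i : ℕ)) = (Matrix.vandermonde x).det := by
  rw [← Matrix.det_transpose]
  rfl

theorem alternant_eq {N : ℕ} (x : Fin N → ℝ) (y : Fin N → ℕ) :
    alternant x y = shiftDet (homogeneousSumInt x) (fun i => (y i : ℤ)) *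
      (Matrix.vandermonde x).det := by
  rw [alternant_eq_mul_det x y, ← alternant_id, alternant_eq_mul_det x (fun i => (i : ℕ)),
    shiftDet_id (homogeneousSumInt_of_neg x) (homogeneousSumInt_zero x), one_mul]

theorem sum_alternant_add {N : ℕ} (x : Fin N → ℝ) (y : Fin N → ℕ) :
    ∑ i, alternant x (y + Pi.single i 1) = (∑ i, x i) * alternant x y := by
  simp only [alternant, Matrix.det_apply', Matrix.of_apply]
  rw [Finset.sum_comm, Finset.mul_sum]
  refine Finset.sum_congr rfl fun σ _ => ?_
  rw [← Finset.mul_sum, mul_left_comm]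
  congr 1
  have key := sum_prod_update (A := fun l => x l ^ y (σ l))
    (B := fun l => x l ^ (y (σ l) + 1)) (c := x) (fun l => pow_succ' _ _)
  rw [← key, ← Equiv.sum_comp σ]
  refine Finset.sum_congr rfl fun i _ => Finset.prod_congr rfl fun l _ => ?_
  by_cases h : l = i
  · subst h
    simp
  · simp [h, σ.injective.eq_iff]

/-! ### Density of the interior and positivity -/

theorem vandermonde_pos {N : ℕ} {x : Fin N → ℝ} (hx : StrictMono x) :
    0 < (Matrix.vandermonde x).det := by
  rw [Matrix.det_vandermonde]
  refine Finset.prod_pos fun i _ => Finset.prod_pos fun j hj => ?_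
  exact sub_pos.2 (hx (Finset.mem_Ioi.1 hj))

theorem mem_closure_pos {N : ℕ} {x : Fin N → ℝ} (hx : x ∈ contChamber N) :
    x ∈ closure {z : Fin N → ℝ | (∀ i, 0 < z i) ∧ StrictMono z} := by
  have hc : Continuous fun ε : ℝ => fun i : Fin N => x i + ε * ((i : ℕ) + 1) := by fun_prop
  have ht : Tendsto (fun ε : ℝ => fun i : Fin N => x i + ε * ((i : ℕ) + 1)) (𝓝[>] 0) (𝓝 x) := by
    have := hc.tendsto 0
    simp only [zero_mul, add_zero] at this
    exact this.mono_left nhdsWithin_le_nhds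
  refine mem_closure_of_tendsto ht ?_
  filter_upwards [self_mem_nhdsWithin] with ε hε
  have hε : 0 < ε := hε
  refine ⟨fun i => ?_, fun i j hij => ?_⟩
  · have := hx.1 i
    positivity
  · have h1 := hx.2 hij.le
    have h2 : ((i : ℕ) : ℝ) < (j : ℕ) := by exact_mod_cast hij
    have h3 := mul_lt_mul_of_pos_left h2 hε
    simp only
    linarith

theorem mem_closure_contChamberInterior {N : ℕ} {x : Fin N → ℝ} (hx : x ∈ contChamber N) :
    x ∈ closure (contChamberInterior N) := by
  refine closure_mono ?_ (mem_closure_pos hx)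
  rintro z ⟨hz, hz'⟩
  exact ⟨fun i => (hz i).le, hz'⟩

theorem continuous_shiftDet {N : ℕ} (y : Fin N → ℤ) :
    Continuous fun x : Fin N → ℝ => shiftDet (homogeneousSumInt x) y := by
  unfold shiftDet
  refine Continuous.matrix_det ?_
  exact continuous_matrix fun i k => continuous_homogeneousSumInt _

theorem sum_shiftDet_add {N : ℕ} {x : Fin N → ℝ} (hx : x ∈ contChamber N) {y : Fin N → ℤ}
    (hy : ∀ i, 0 ≤ y i) :
    ∑ i, shiftDet (homogeneousSumInt x) (y + Pi.single i 1) =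
      (∑ i, x i) * shiftDet (homogeneousSumInt x) y := by
  lift y to Fin N → ℕ using hy
  have hclosed : IsClosed {x : Fin N → ℝ |
      ∑ i, shiftDet (homogeneousSumInt x) ((fun j => (y j : ℤ)) + Pi.single i 1) =
      (∑ i, x i) * shiftDet (homogeneousSumInt x) (fun j => (y j : ℤ))} := by
    refine isClosed_eq ?_ ?_
    · exact continuous_finsetSum _ fun i _ => continuous_shiftDet _
    · exact (continuous_finsetSum _ fun i _ => continuous_apply i).mul (continuous_shiftDet _)
  refine hclosed.closure_subset_iff.2 ?_ (mem_closure_contChamberInterior hx)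
  intro z hz
  have hv := (vandermonde_pos hz.2).ne'
  have h1 := sum_alternant_add z y
  simp only [alternant_eq, ← Finset.sum_mul] at h1
  rw [← mul_assoc] at h1
  have h2 := mul_right_cancel₀ hv h1
  have h3 : ∀ i, (fun j => (((y + Pi.single i 1 : Fin N → ℕ) j : ℕ) : ℤ)) =
      (fun j => (y j : ℤ)) + Pi.single i 1 := by
    intro i
    funext j
    by_cases h : j = i
    · subst h
      simp
    · simp [h]
  simp only [h3] at h2
  exact h2

theorem signVariations_lt_card_support {P : Polynomial ℝ} (hP : P ≠ 0) :
    P.signVariations < P.support.card := by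
  induction h : P.support.card using Nat.strong_induction_on generalizing P with
  | _ n ih =>
    have h1 := Polynomial.card_support_eraseLead_add_one hP
    by_cases h0 : P.eraseLead = 0
    · have h2 := Polynomial.eraseLead_add_C_mul_X_pow P
      rw [h0, zero_add, Polynomial.C_mul_X_pow_eq_monomial] at h2
      rw [← h2, Polynomial.signVariations_monomial]
      omega
    · have h2 := ih _ (by omega) h0 rfl
      have h3 := Polynomial.signVariations_le_eraseLead_succ P
      omega

theorem card_pos_roots_lt {P : Polynomial ℝ} (hP : P ≠ 0) {s : Finset ℝ}
    (hs : ∀ a ∈ s, 0 < a ∧ P.eval a = 0) : s.card < P.support.card := by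
  refine lt_of_le_of_lt ?_ (signVariations_lt_card_support hP)
  refine le_trans ?_ P.roots_countP_pos_le_signVariations
  rw [Multiset.countP_eq_card_filter]
  refine Multiset.card_le_card ?_
  rw [Multiset.le_iff_subset s.nodup]
  intro a ha
  have := hs a ha
  rw [Multiset.mem_filter, Polynomial.mem_roots hP]
  exact ⟨this.2, this.1⟩

theorem alternant_pos {N : ℕ} {x : Fin N → ℝ} (hx : ∀ i, 0 < x i) (hx' : StrictMono x)
    {y : Fin N → ℕ} (hy : StrictMono y) : 0 < alternant x y := by
  induction N with
  | zero => simp [alternant]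
  | succ N ih =>
    have hlast := ih (x := x ∘ Fin.castSucc) (fun i => hx _)
      (hx'.comp Fin.strictMono_castSucc) (y := y ∘ Fin.castSucc) (hy.comp Fin.strictMono_castSucc)
    let z : ℝ → Fin (N + 1) → ℝ := fun t => Fin.snoc (α := fun _ => ℝ) (x ∘ Fin.castSucc) t
    let c : Fin (N + 1) → ℝ := fun i => (-1) ^ ((i : ℕ) + N) *
      (Matrix.of fun a b : Fin N => x b.castSucc ^ y (i.succAbove a)).det
    let P : Polynomial ℝ := ∑ i, Polynomial.monomial (y i) (c i)
    have hP : ∀ t, P.eval t = alternant (z t) y := by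
      intro t
      rw [alternant, Matrix.det_succ_column _ (Fin.last N)]
      simp only [P, Polynomial.eval_finsetSum, Polynomial.eval_monomial]
      refine Finset.sum_congr rfl fun i _ => ?_
      have h1 : ((Matrix.of fun i k => z t k ^ y i).submatrix i.succAbove
          (Fin.last N).succAbove) =
          Matrix.of fun a b : Fin N => x b.castSucc ^ y (i.succAbove a) := by
        ext a b
        simp [z]
      rw [h1]
      simp only [c, z, Fin.val_last, Matrix.of_apply, Fin.snoc_last]
      ring
    have hzx : z (x (Fin.last N)) = x := by
      funext i
      refine Fin.lastCases ?_ (fun i => ?_) i <;> simp [z]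
    have hc : c (Fin.last N) = alternant (x ∘ Fin.castSucc) (y ∘ Fin.castSucc) := by
      simp [c, alternant, ← two_mul]
    have hcoeff : ∀ m, P.coeff m = ∑ i, if y i = m then c i else 0 := by
      intro m
      simp [P, Polynomial.finsetSum_coeff, Polynomial.coeff_monomial]
    have hlc : P.coeff (y (Fin.last N)) = c (Fin.last N) := by
      rw [hcoeff]
      simp [hy.injective.eq_iff]
    have hsupp : P.support ⊆ Finset.univ.image y := by
      intro m hm
      rw [Polynomial.mem_support_iff, hcoeff] at hm
      obtain ⟨i, -, hi⟩ := Finset.exists_ne_zero_of_sum_ne_zero hm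
      rw [Finset.mem_image]
      exact ⟨i, Finset.mem_univ i, by by_contra h; simp [h] at hi⟩
    have hcard : P.support.card ≤ N + 1 := by
      refine (Finset.card_le_card hsupp).trans (Finset.card_image_le.trans ?_)
      simp
    have hP0 : P ≠ 0 := by
      intro h
      rw [h, Polynomial.coeff_zero] at hlc
      linarith
    have hne : ∀ t, x (Fin.last N) ≤ t → P.eval t ≠ 0 := by
      intro t ht h0
      have hmono : StrictMono (z t) := by
        intro i j hij
        induction j using Fin.lastCases with
        | last =>
          induction i using Fin.lastCases with
          | last => exact absurd hij (lt_irrefl _)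
          | cast i =>
            simp only [z, Fin.snoc_castSucc, Fin.snoc_last, Function.comp_apply]
            exact (hx' (Fin.castSucc_lt_last i)).trans_le ht
        | cast j =>
          induction i using Fin.lastCases with
          | last => exact absurd hij (Fin.castSucc_lt_last j).not_gt
          | cast i =>
            simp only [z, Fin.snoc_castSucc, Function.comp_apply]
            exact hx' hij
      have h2 := card_pos_roots_lt hP0 (s := Finset.univ.image (z t)) (by
        intro a ha
        obtain ⟨i, -, rfl⟩ := Finset.mem_image.1 ha
        induction i using Fin.lastCases with
        | last =>
          simp only [z, Fin.snoc_last]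
          exact ⟨(hx _).trans_le ht, h0⟩
        | cast i =>
          simp only [z, Fin.snoc_castSucc, Function.comp_apply]
          refine ⟨hx _, ?_⟩
          rw [hP]
          refine Matrix.det_zero_of_column_eq (Fin.castSucc_lt_last i).ne fun k => ?_
          simp [z])
      rw [Finset.card_image_of_injective _ hmono.injective, Finset.card_fin] at h2
      omega
    have hpos : 0 < P.eval (x (Fin.last N)) := by
      by_contra hle
      rw [not_lt] at hle
      have hdeg : P.natDegree = y (Fin.last N) := by
        refine Polynomial.natDegree_eq_of_le_of_coeff_ne_zero ?_ (by rw [hlc, hc]; exact hlast.ne')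
        rw [Polynomial.natDegree_le_iff_coeff_eq_zero]
        intro m hm
        rw [hcoeff]
        refine Finset.sum_eq_zero fun i _ => if_neg ?_
        have := hy.monotone (Fin.le_last i)
        omega
      have hlead : P.leadingCoeff = c (Fin.last N) := by
        rw [Polynomial.leadingCoeff, hdeg, hlc]
      obtain ⟨t, ht, ht'⟩ : ∃ t, x (Fin.last N) ≤ t ∧ 0 ≤ P.eval t := by
        by_cases hd : 0 < P.degree
        · have := Polynomial.tendsto_atTop_of_leadingCoeff_nonneg P hd
            (by rw [hlead, hc]; exact hlast.le)
          exact ((eventually_ge_atTop _).and (this.eventually_ge_atTop 0)).exists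
        · refine ⟨_, le_rfl, ?_⟩
          rw [Polynomial.eq_C_of_degree_le_zero (not_lt.1 hd), Polynomial.eval_C]
          have h0 : P.natDegree = 0 :=
            Polynomial.natDegree_eq_zero_iff_degree_le_zero.2 (not_lt.1 hd)
          rw [← h0]
          change 0 ≤ P.leadingCoeff
          rw [hlead, hc]
          exact hlast.le
      obtain ⟨u, hu, hu'⟩ := intermediate_value_Icc ht P.continuousOn ⟨hle, ht'⟩
      exact hne u hu.1 hu'
    rwa [hP, hzx] at hpos

theorem shiftDet_homogeneousSumInt_nonneg {N : ℕ} {x : Fin N → ℝ} (hx : x ∈ contChamber N)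
    (y : DiscreteChamber N) :
    0 ≤ shiftDet (homogeneousSumInt x) (fun i => (y.1 i : ℤ)) := by
  have hclosed : IsClosed {x : Fin N → ℝ |
      0 ≤ shiftDet (homogeneousSumInt x) (fun i => (y.1 i : ℤ))} :=
    isClosed_le continuous_const (continuous_shiftDet _)
  refine hclosed.closure_subset_iff.2 ?_ (mem_closure_pos hx)
  rintro z ⟨hz, hz'⟩
  have h := alternant_pos hz hz' y.2
  rw [alternant_eq] at h
  exact (pos_of_mul_pos_left h (vandermonde_pos hz').le).le

/-! ### Schur functions as shift determinants -/

/-- The coordinates of the image of a diagram in the discrete chamber, as integers. -/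
def chamberVec (N : ℕ) (ν : YoungDiagram) (i : Fin N) : ℤ := ((toDiscreteChamber N ν).1 i : ℤ)

theorem chamberVec_apply (N : ℕ) (ν : YoungDiagram) (i : Fin N) :
    chamberVec N ν i = (ν.rowLen (Fin.rev i : ℕ) : ℤ) + (i : ℕ) := by
  simp [chamberVec, toDiscreteChamber]

theorem completeHomogeneousInt_of_neg (ω : ThomaCone) {m : ℤ} (hm : m < 0) :
    completeHomogeneousInt ω m = 0 := if_pos hm

theorem schur_eq_det {N : ℕ} {ν : YoungDiagram} (hν : ν ∈ atMostRows N) (ω : ThomaCone) :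
    schur ω ν = (Matrix.of fun i j : Fin N =>
      completeHomogeneousInt ω ((ν.rowLen i : ℤ) - (i : ℤ) + (j : ℤ))).det := by
  have hν : ν.colLen 0 ≤ N := hν
  induction N, hν using Nat.le_induction with
  | base => rfl
  | succ n hn ih =>
    have h0 : ν.rowLen n = 0 := rowLen_eq_zero_of_mem (N := n) hn le_rfl
    rw [ih hn, Matrix.det_succ_row _ (Fin.last n), Fin.sum_univ_castSucc, Finset.sum_eq_zero,
      zero_add]
    · have h1 : completeHomogeneousInt ω 0 = 1 := by
        simp [completeHomogeneousInt, completeHomogeneous]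
      simp only [Fin.succAbove_last, Matrix.of_apply, Fin.val_last, h0]
      simp only [Nat.cast_zero, zero_sub, neg_add_cancel, h1, ← two_mul, pow_mul]
      simp only [even_two, Even.neg_pow, one_pow, mul_one, one_mul]
      rfl
    · intro j _
      have hj := j.2
      rw [Matrix.of_apply, completeHomogeneousInt_of_neg]
      · simp
      · simp only [Fin.val_last, h0, Fin.val_castSucc]
        omega

theorem schur_omegaPoint {N : ℕ} {ν : YoungDiagram} (hν : ν ∈ atMostRows N) (x : contChamber N) :
    schur (omegaPoint x) ν = shiftDet (homogeneousSumInt x.1) (chamberVec N ν) := by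
  rw [schur_eq_det hν, shiftDet, ← Matrix.det_submatrix_equiv_self Fin.revPerm]
  congr 1
  ext i j
  simp only [Matrix.submatrix_apply, Matrix.of_apply, completeHomogeneousInt_omegaPoint,
    chamberVec_apply, Fin.revPerm_apply]
  congr 1
  simp only [Fin.val_rev]
  omega

theorem schur_omegaPoint_eq_zero {N : ℕ} {ν : YoungDiagram} (hν : ν ∉ atMostRows N)
    (x : contChamber N) : schur (omegaPoint x) ν = 0 := by
  have hν : N < ν.colLen 0 := not_le.1 hν
  obtain ⟨l, hl⟩ : ∃ l, ν.colLen 0 = l + 1 := ⟨ν.colLen 0 - 1, by omega⟩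
  let q : Polynomial ℝ := ∏ i, (1 - Polynomial.C (x.1 i) * Polynomial.X)
  have hq : q.natDegree < ν.colLen 0 := by
    have := natDegree_prod_one_sub_le x.1 Finset.univ
    rw [Finset.card_fin] at this
    exact this.trans_lt hν
  have hq1 : homogeneousSeries x.1 * (q : PowerSeries ℝ) = 1 :=
    homogeneousSeries_mul_prod x.1 Finset.univ
  have hq0 : q.coeff 0 = 1 := by
    simp [q, Polynomial.coeff_zero_eq_eval_zero, Polynomial.eval_prod]
  refine Matrix.exists_mulVec_eq_zero_iff.1
    ⟨fun j => q.coeff (Fin.rev j : ℕ), fun h => ?_, ?_⟩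
  · have := congrFun h (⟨l, by omega⟩ : Fin (ν.colLen 0))
    simp only [Fin.val_rev, hl, Nat.sub_self, hq0] at this
    exact one_ne_zero this
  · funext i
    have hi := i.2
    have hpos : 0 < ν.rowLen i :=
      YoungDiagram.mem_iff_lt_rowLen.1 (YoungDiagram.mem_iff_lt_colLen.2 hi)
    have key := coeff_homogeneousSeries_mul x.1 hq (ν.rowLen i + l - i)
    rw [hq1, PowerSeries.coeff_one, if_neg (by omega)] at key
    rw [Matrix.mulVec, dotProduct, Pi.zero_apply, key, ← Equiv.sum_comp Fin.revPerm]
    refine Finset.sum_congr rfl fun j _ => ?_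
    have hj := j.2
    simp only [Matrix.of_apply, completeHomogeneousInt_omegaPoint, Fin.revPerm_apply, Fin.rev_rev,
      Fin.val_rev]
    congr 2
    omega

/-! ### Boxes of a diagram and its image in the discrete chamber -/

theorem card_eq_sum_rowLen {N : ℕ} {ν : YoungDiagram} (hν : ν ∈ atMostRows N) :
    ν.card = ∑ i : Fin N, ν.rowLen i := by
  rw [← Finset.sum_range fun i => ν.rowLen i]
  refine (Finset.card_eq_sum_card_fiberwise (f := Prod.fst) (t := Finset.range N) ?_).trans ?_
  · intro c hc
    have h1 : (c.1, c.2) ∈ ν := (YoungDiagram.mem_cells c).1 hc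
    rw [Finset.mem_coe, Finset.mem_range]
    by_contra h
    rw [YoungDiagram.mem_iff_lt_rowLen, rowLen_eq_zero_of_mem hν (not_lt.1 h)] at h1
    omega
  · exact Finset.sum_congr rfl fun i _ => (ν.rowLen_eq_card).symm

theorem sum_chamberVec {N : ℕ} {ν : YoungDiagram} (hν : ν ∈ atMostRows N) :
    ∑ i, chamberVec N ν i = ν.card + ∑ i : Fin N, ((i : ℕ) : ℤ) := by
  simp only [chamberVec_apply, Finset.sum_add_distrib, card_eq_sum_rowLen hν]
  rw [← Equiv.sum_comp Fin.revPerm]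
  simp

theorem chamberVec_injOn {N : ℕ} : Set.InjOn (chamberVec N) (atMostRows N) := by
  intro μ hμ ν hν h
  have h1 : toDiscreteChamber N μ = toDiscreteChamber N ν := by
    apply Subtype.ext
    funext i
    exact Int.ofNat.inj (congrFun h i)
  exact congrArg Subtype.val
    ((toDiscreteChamber_bijective N).1 (a₁ := ⟨μ, hμ⟩) (a₂ := ⟨ν, hν⟩) h1)

theorem chamberVec_strictMono (N : ℕ) (ν : YoungDiagram) : StrictMono (chamberVec N ν) :=
  fun _ _ hij => Int.ofNat_lt.2 ((toDiscreteChamber N ν).2 hij)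

theorem exists_chamberVec_eq {N : ℕ} {y : Fin N → ℤ} (hy : StrictMono y) (hy0 : ∀ i, 0 ≤ y i) :
    ∃ μ ∈ atMostRows N, chamberVec N μ = y := by
  lift y to Fin N → ℕ using hy0
  obtain ⟨⟨μ, hμ⟩, h⟩ := (toDiscreteChamber_bijective N).2
    ⟨y, fun i j hij => Int.ofNat_lt.1 (hy hij)⟩
  refine ⟨μ, hμ, ?_⟩
  funext i
  exact congrArg Int.ofNat (congrFun (congrArg Subtype.val h) i)

theorem le_iff_rowLen_le {μ ν : YoungDiagram} : μ ≤ ν ↔ ∀ k, μ.rowLen k ≤ ν.rowLen k := by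
  constructor
  · intro h k
    by_contra hlt
    have h1 : (k, ν.rowLen k) ∈ μ := YoungDiagram.mem_iff_lt_rowLen.2 (not_le.1 hlt)
    exact lt_irrefl _ (YoungDiagram.mem_iff_lt_rowLen.1 (h h1))
  · rintro h ⟨a, b⟩ hc
    exact YoungDiagram.mem_iff_lt_rowLen.2 ((YoungDiagram.mem_iff_lt_rowLen.1 hc).trans_le (h a))

theorem mem_atMostRows_of_le {N : ℕ} {μ ν : YoungDiagram} (h : μ ≤ ν) (hν : ν ∈ atMostRows N) :
    μ ∈ atMostRows N := by
  change μ.colLen 0 ≤ N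
  by_contra hlt
  have h1 : (N, 0) ∈ ν := h (YoungDiagram.mem_iff_lt_colLen.2 (not_le.1 hlt))
  have h2 := YoungDiagram.mem_iff_lt_colLen.1 h1
  have h3 : ν.colLen 0 ≤ N := hν
  omega

theorem le_iff_chamberVec_le {N : ℕ} {μ ν : YoungDiagram} (hμ : μ ∈ atMostRows N) :
    μ ≤ ν ↔ chamberVec N μ ≤ chamberVec N ν := by
  rw [le_iff_rowLen_le]
  constructor
  · intro h i
    have := h (Fin.rev i)
    simp only [chamberVec_apply]
    omega
  · intro h k
    by_cases hk : k < N
    · have := h (Fin.rev ⟨k, hk⟩)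
      simp only [chamberVec_apply, Fin.rev_rev] at this
      omega
    · rw [rowLen_eq_zero_of_mem hμ (not_lt.1 hk)]
      exact Nat.zero_le _

theorem exists_eq_single_of_sum_eq_one {N : ℕ} {d : Fin N → ℤ} (hd : ∀ i, 0 ≤ d i)
    (hs : ∑ i, d i = 1) : ∃ i, d = Pi.single i 1 := by
  obtain ⟨i, -, hi⟩ := Finset.exists_ne_zero_of_sum_ne_zero (by rw [hs]; exact one_ne_zero)
  have h1 := Finset.add_sum_erase Finset.univ d (Finset.mem_univ i)
  have h2 : 0 ≤ ∑ j ∈ Finset.univ.erase i, d j := Finset.sum_nonneg fun j _ => hd j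
  have h3 := hd i
  have h4 : ∑ j ∈ Finset.univ.erase i, d j = 0 := by omega
  rw [Finset.sum_eq_zero_iff_of_nonneg fun j _ => hd j] at h4
  refine ⟨i, ?_⟩
  funext j
  by_cases hj : j = i
  · subst hj
    rw [Pi.single_eq_same]
    omega
  · rw [Pi.single_eq_of_ne hj, h4 j (Finset.mem_erase.2 ⟨hj, Finset.mem_univ j⟩)]

theorem edge_iff_chamberVec {N : ℕ} {μ ν : YoungDiagram} (hμ : μ ∈ atMostRows N)
    (hν : ν ∈ atMostRows N) :
    Edge μ ν ↔ ∃ i, chamberVec N μ = chamberVec N ν - Pi.single i 1 := by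
  have h1 := sum_chamberVec hμ
  have h2 := sum_chamberVec hν
  rw [Edge, le_iff_chamberVec_le hμ]
  constructor
  · rintro ⟨hle, hcard⟩
    obtain ⟨i, hi⟩ := exists_eq_single_of_sum_eq_one (d := chamberVec N ν - chamberVec N μ)
      (fun i => sub_nonneg.2 (hle i)) (by
        simp only [Pi.sub_apply, Finset.sum_sub_distrib]
        omega)
    exact ⟨i, by rw [← hi, sub_sub_cancel]⟩
  · rintro ⟨i, hi⟩
    have hs : ∑ j, chamberVec N μ j = ∑ j, chamberVec N ν j - 1 := by
      simp only [hi, Pi.sub_apply, Finset.sum_sub_distrib]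
      simp
    refine ⟨?_, by omega⟩
    rw [hi, sub_le_self_iff, Pi.single_nonneg]
    exact zero_le_one

theorem strictMono_sub_single {N : ℕ} {y : Fin N → ℤ} (hy : StrictMono y) {i : Fin N}
    (hinj : Function.Injective (y - Pi.single i 1)) : StrictMono (y - Pi.single i 1) := by
  refine Monotone.strictMono_of_injective (fun a b hab => ?_) hinj
  rcases hab.eq_or_lt with rfl | h
  · exact le_rfl
  · have := hy h
    simp only [Pi.sub_apply, Pi.single_apply]
    split_ifs <;> omega

theorem strictMono_add_single {N : ℕ} {y : Fin N → ℤ} (hy : StrictMono y) {i : Fin N}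
    (hinj : Function.Injective (y + Pi.single i 1)) : StrictMono (y + Pi.single i 1) := by
  refine Monotone.strictMono_of_injective (fun a b hab => ?_) hinj
  rcases hab.eq_or_lt with rfl | h
  · exact le_rfl
  · have := hy h
    simp only [Pi.add_apply, Pi.single_apply]
    split_ifs <;> omega

/-! ### The number of paths in the Young graph -/

/-- Paths of length `n` in the Young graph from the empty diagram to `ν`. -/
abbrev YoungPath (n : ℕ) (ν : YoungDiagram) : Type :=
  {p : Fin (n + 1) → YoungDiagram //
    p 0 = ⊥ ∧ p (Fin.last n) = ν ∧ ∀ i : Fin n, Edge (p i.castSucc) (p i.succ)}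

theorem youngPath_sigma_ext {n : ℕ} {ν : YoungDiagram}
    {q q' : Σ μ : {μ // Edge μ ν}, YoungPath n μ.1} (h : q.1.1 = q'.1.1)
    (h' : q.2.1 = q'.2.1) : q = q' := by
  obtain ⟨⟨μ, hμ⟩, ⟨p, hp⟩⟩ := q
  obtain ⟨⟨μ', hμ'⟩, ⟨p', hp'⟩⟩ := q'
  obtain rfl : μ = μ' := h
  obtain rfl : p = p' := h'
  rfl

/-- A path of length `n + 1` is a path of length `n` followed by an edge. -/
def youngPathSuccEquiv (n : ℕ) (ν : YoungDiagram) :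
    YoungPath (n + 1) ν ≃ Σ μ : {μ // Edge μ ν}, YoungPath n μ.1 where
  toFun p := ⟨⟨p.1 (Fin.last n).castSucc, by
      have := p.2.2.2 (Fin.last n)
      rwa [Fin.succ_last, p.2.2.1] at this⟩,
    ⟨fun i => p.1 i.castSucc, p.2.1, rfl, fun i => p.2.2.2 i.castSucc⟩⟩
  invFun q := ⟨Fin.snoc (α := fun _ => YoungDiagram) q.2.1 ν, by
      exact (Fin.snoc_castSucc (α := fun _ => YoungDiagram) ν q.2.1 0).trans q.2.2.1,
    by rw [Fin.snoc_last], by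
      intro i
      induction i using Fin.lastCases with
      | last =>
        rw [Fin.snoc_castSucc, Fin.succ_last, Fin.snoc_last, q.2.2.2.1]
        exact q.1.2
      | cast i =>
        rw [Fin.snoc_castSucc, Fin.succ_castSucc, Fin.snoc_castSucc]
        exact q.2.2.2.2 i⟩
  left_inv p := by
    apply Subtype.ext
    funext i
    induction i using Fin.lastCases with
    | last => simp [p.2.2.1]
    | cast i => simp
  right_inv q := by
    refine youngPath_sigma_ext ?_ ?_
    · exact (Fin.snoc_castSucc (α := fun _ => YoungDiagram) ν q.2.1 _).trans q.2.2.2.1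
    · funext i
      exact Fin.snoc_castSucc (α := fun _ => YoungDiagram) ν q.2.1 i

instance finite_edge (ν : YoungDiagram) : Finite {μ // Edge μ ν} :=
  Finite.of_injective
    (fun μ => (⟨μ.1.cells, Finset.mem_powerset.2 (YoungDiagram.cells_subset_iff.2 μ.2.1)⟩ :
      ν.cells.powerset))
    fun _ _ h => Subtype.ext (YoungDiagram.ext (congrArg Subtype.val h))

theorem sum_edge_eq {N : ℕ} {ν : YoungDiagram} (hν : ν ∈ atMostRows N) [Fintype {μ // Edge μ ν}]
    {f : ℤ → ℝ} (hf : ∀ m < 0, f m = 0) :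
    ∑ μ : {μ // Edge μ ν}, shiftDet f (chamberVec N μ.1) =
      ∑ i, shiftDet f (chamberVec N ν - Pi.single i 1) := by
  have hmem : ∀ μ : {μ // Edge μ ν}, μ.1 ∈ atMostRows N := fun μ =>
    mem_atMostRows_of_le μ.2.1 hν
  choose e he using fun μ : {μ // Edge μ ν} => (edge_iff_chamberVec (hmem μ) hν).1 μ.2
  refine Finset.sum_of_injOn e ?_ (fun _ _ => Finset.mem_coe.2 (Finset.mem_univ _)) ?_
    fun μ _ => by rw [he]
  · intro μ _ μ' _ h
    refine Subtype.ext (chamberVec_injOn (hmem μ) (hmem μ') ?_)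
    rw [he, he, h]
  · intro i _ hi
    by_contra hne
    have hinj : Function.Injective (chamberVec N ν - Pi.single i 1) := by
      by_contra h
      exact hne (shiftDet_eq_zero_of_not_injective f h)
    obtain ⟨μ, hμ, h⟩ := exists_chamberVec_eq
      (strictMono_sub_single (chamberVec_strictMono N ν) hinj) (fun j => by
        by_contra h
        exact hne (shiftDet_eq_zero_of_neg hf (not_le.1 h)))
    refine hi ⟨⟨μ, (edge_iff_chamberVec hμ hν).2 ⟨i, h⟩⟩, Finset.mem_coe.2 (Finset.mem_univ _), ?_⟩
    have h1 := (he ⟨μ, (edge_iff_chamberVec hμ hν).2 ⟨i, h⟩⟩).symm.trans h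
    have h2 := congrFun (sub_right_injective h1) i
    by_contra h3
    rw [Pi.single_eq_same, Pi.single_eq_of_ne (Ne.symm h3)] at h2
    exact zero_ne_one h2

theorem chamberVec_bot (N : ℕ) : chamberVec N ⊥ = fun i : Fin N => ((i : ℕ) : ℤ) := by
  have h0 : ∀ k, (⊥ : YoungDiagram).rowLen k = 0 := by
    intro k
    by_contra h
    exact YoungDiagram.notMem_bot (k, 0)
      (YoungDiagram.mem_iff_lt_rowLen.2 (Nat.pos_of_ne_zero h))
  funext i
  rw [chamberVec_apply, h0]
  simp

theorem card_youngPath {N : ℕ} (n : ℕ) {ν : YoungDiagram} (hν : ν ∈ atMostRows N)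
    (hn : ν.card = n) :
    Finite (YoungPath n ν) ∧
      (Nat.card (YoungPath n ν) : ℝ) = n.factorial * shiftDet invFactorial (chamberVec N ν) := by
  induction n generalizing ν with
  | zero =>
    obtain rfl : ν = ⊥ := by
      apply YoungDiagram.ext
      rw [YoungDiagram.cells_bot]
      exact Finset.card_eq_zero.1 hn
    have hu : Nonempty (Unique (YoungPath 0 ⊥)) := by
      refine ⟨⟨⟨⟨fun _ => ⊥, rfl, rfl, fun i => i.elim0⟩⟩, fun p => ?_⟩⟩
      apply Subtype.ext
      funext i
      rw [Fin.fin_one_eq_zero i]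
      exact p.2.1
    obtain ⟨_⟩ := hu
    refine ⟨inferInstance, ?_⟩
    rw [Nat.card_unique, chamberVec_bot, shiftDet_id invFactorial_of_neg invFactorial_zero]
    simp
  | succ n ih =>
    have := Fintype.ofFinite {μ // Edge μ ν}
    have hcard : ∀ μ : {μ // Edge μ ν}, μ.1.card = n := fun μ => by
      have := μ.2.2
      omega
    have hmem : ∀ μ : {μ // Edge μ ν}, μ.1 ∈ atMostRows N := fun μ =>
      mem_atMostRows_of_le μ.2.1 hν
    have hfin : ∀ μ : {μ // Edge μ ν}, Finite (YoungPath n μ.1) := fun μ =>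
      (ih (hmem μ) (hcard μ)).1
    refine ⟨Finite.of_equiv _ (youngPathSuccEquiv n ν).symm, ?_⟩
    rw [Nat.card_congr (youngPathSuccEquiv n ν), Nat.card_sigma, Nat.cast_sum,
      Finset.sum_congr rfl fun μ _ => (ih (hmem μ) (hcard μ)).2, ← Finset.mul_sum,
      sum_edge_eq hν invFactorial_of_neg, sum_shiftDet_sub invFactorial_sub_one,
      Nat.factorial_succ]
    have h1 : ∑ i, (chamberVec N ν i : ℝ) = (n + 1) + ∑ i : Fin N, ((i : ℕ) : ℝ) := by
      have h := sum_chamberVec hν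
      rw [hn] at h
      exact_mod_cast h
    rw [h1]
    push_cast
    ring

theorem dim_div_factorial {N : ℕ} {ν : YoungDiagram} (hν : ν ∈ atMostRows N) :
    (dim ν : ℝ) / ν.card.factorial = shiftDet invFactorial (chamberVec N ν) := by
  have h : (ν.card.factorial : ℝ) ≠ 0 := by positivity
  rw [div_eq_iff h, mul_comm]
  exact (card_youngPath ν.card hν rfl).2

/-! ### Summation over the levels of the discrete chamber -/

/-- The points of the discrete chamber that correspond to diagrams with `n` boxes. -/
def chamberLevel (N n : ℕ) : Finset (Fin N → ℤ) :=
  {y ∈ Finset.Icc 0 (fun _ => n + ∑ i : Fin N, ((i : ℕ) : ℤ)) |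
    StrictMono y ∧ ∑ i, y i = n + ∑ i : Fin N, ((i : ℕ) : ℤ)}

theorem mem_chamberLevel {N n : ℕ} {y : Fin N → ℤ} :
    y ∈ chamberLevel N n ↔
      (∀ i, 0 ≤ y i) ∧ StrictMono y ∧ ∑ i, y i = n + ∑ i : Fin N, ((i : ℕ) : ℤ) := by
  rw [chamberLevel, Finset.mem_filter, Finset.mem_Icc]
  constructor
  · rintro ⟨⟨h, -⟩, h'⟩
    exact ⟨h, h'⟩
  · rintro ⟨h, h'⟩
    refine ⟨⟨h, fun i => ?_⟩, h'⟩
    rw [← h'.2]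
    exact Finset.single_le_sum (fun j _ => h j) (Finset.mem_univ i)

theorem sum_chamberLevel_succ {N : ℕ} (n : ℕ) {f g : ℤ → ℝ} (hf : ∀ m < 0, f m = 0) :
    ∑ y ∈ chamberLevel N (n + 1), ∑ i, shiftDet f (y - Pi.single i 1) * shiftDet g y =
      ∑ y ∈ chamberLevel N n, ∑ i, shiftDet f y * shiftDet g (y + Pi.single i 1) := by
  rw [← Finset.sum_product', ← Finset.sum_product']
  refine Finset.sum_bij_ne_zero (fun p _ _ => (p.1 - Pi.single p.2 1, p.2)) ?_ ?_ ?_ ?_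
  · rintro ⟨y, i⟩ hy hne
    simp only [Finset.mem_product, mem_chamberLevel, Finset.mem_univ, and_true] at hy ⊢
    have hne := left_ne_zero_of_mul hne
    refine ⟨fun j => ?_, strictMono_sub_single hy.2.1 ?_, ?_⟩
    · by_contra h
      exact hne (shiftDet_eq_zero_of_neg hf (not_le.1 h))
    · by_contra h
      exact hne (shiftDet_eq_zero_of_not_injective f h)
    · simp only [Pi.sub_apply, Finset.sum_sub_distrib, hy.2.2]
      simp
      ring
  · rintro ⟨y, i⟩ _ _ ⟨y', i'⟩ _ _ h
    obtain ⟨h1, rfl⟩ := Prod.mk.inj h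
    exact congrArg (·, i) (sub_left_injective h1)
  · rintro ⟨y, i⟩ hy hne
    simp only [Finset.mem_product, mem_chamberLevel, Finset.mem_univ, and_true] at hy
    refine ⟨(y + Pi.single i 1, i), ?_, ?_, ?_⟩
    · simp only [Finset.mem_product, mem_chamberLevel, Finset.mem_univ, and_true]
      refine ⟨fun j => add_nonneg (hy.1 j) ?_, strictMono_add_single hy.2.1 ?_, ?_⟩
      · exact (Pi.single_nonneg.2 zero_le_one : (0 : Fin N → ℤ) ≤ Pi.single i 1) j
      · by_contra h
        exact right_ne_zero_of_mul hne (shiftDet_eq_zero_of_not_injective g h)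
      · simp only [Pi.add_apply, Finset.sum_add_distrib, hy.2.2]
        simp
        ring
    · simpa only [add_sub_cancel_right] using hne
    · simp only [add_sub_cancel_right]
  · rintro ⟨y, i⟩ _ _
    simp only [sub_add_cancel]

theorem chamberLevel_zero (N : ℕ) :
    chamberLevel N 0 = {fun i : Fin N => ((i : ℕ) : ℤ)} := by
  ext y
  rw [mem_chamberLevel, Finset.mem_singleton]
  constructor
  · rintro ⟨h0, hmono, hsum⟩
    lift y to Fin N → ℕ using h0
    have hle : ∀ i : Fin N, (i : ℕ) ≤ y i :=
      le_strictMono ⟨y, fun i j hij => Int.ofNat_lt.1 (hmono hij)⟩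
    rw [Nat.cast_zero, zero_add] at hsum
    have := (Finset.sum_eq_sum_iff_of_le fun i _ => Int.ofNat_le.2 (hle i)).1 hsum.symm
    funext i
    exact (this i (Finset.mem_univ i)).symm
  · rintro rfl
    exact ⟨fun i => Int.natCast_nonneg _, fun i j hij => Int.ofNat_lt.2 hij, by simp⟩

theorem sum_chamberLevel {N : ℕ} {x : Fin N → ℝ} (hx : x ∈ contChamber N) (n : ℕ) :
    ∑ y ∈ chamberLevel N n, shiftDet invFactorial y * shiftDet (homogeneousSumInt x) y =
      (∑ i, x i) ^ n / n.factorial := by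
  induction n with
  | zero =>
    rw [chamberLevel_zero, Finset.sum_singleton, shiftDet_id invFactorial_of_neg invFactorial_zero,
      shiftDet_id (homogeneousSumInt_of_neg x) (homogeneousSumInt_zero x)]
    simp
  | succ n ih =>
    have h := sum_chamberLevel_succ (N := N) n (g := homogeneousSumInt x) invFactorial_of_neg
    have h1 : ∀ y ∈ chamberLevel N (n + 1),
        ∑ i, shiftDet invFactorial (y - Pi.single i 1) * shiftDet (homogeneousSumInt x) y =
          (n + 1) * (shiftDet invFactorial y * shiftDet (homogeneousSumInt x) y) := by
      intro y hy
      have h2 : ∑ i, (y i : ℝ) = (n + 1) + ∑ i : Fin N, ((i : ℕ) : ℝ) := by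
        exact_mod_cast (mem_chamberLevel.1 hy).2.2
      rw [← Finset.sum_mul, sum_shiftDet_sub invFactorial_sub_one, h2]
      ring
    have h3 : ∀ y ∈ chamberLevel N n,
        ∑ i, shiftDet invFactorial y * shiftDet (homogeneousSumInt x) (y + Pi.single i 1) =
          (∑ i, x i) * (shiftDet invFactorial y * shiftDet (homogeneousSumInt x) y) := by
      intro y hy
      rw [← Finset.mul_sum, sum_shiftDet_add hx (mem_chamberLevel.1 hy).1]
      ring
    rw [Finset.sum_congr rfl h1, Finset.sum_congr rfl h3, ← Finset.mul_sum, ← Finset.mul_sum,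
      ih] at h
    rw [eq_div_iff (by positivity), Nat.factorial_succ]
    have : (n.factorial : ℝ) ≠ 0 := by positivity
    push_cast
    field_simp at h
    rw [pow_succ]
    linear_combination h

/-- The difference `∑ y_i - ∑ i`, the number of boxes of the corresponding diagram. -/
def chamberSize {N : ℕ} (y : DiscreteChamber N) : ℕ := ∑ i, (y.1 i - (i : ℕ))

theorem natCast_mem_chamberLevel_iff {N n : ℕ} (y : DiscreteChamber N) :
    (fun i => (y.1 i : ℤ)) ∈ chamberLevel N n ↔ chamberSize y = n := by
  have h : ((chamberSize y : ℕ) : ℤ) = ∑ i, (y.1 i : ℤ) - ∑ i : Fin N, ((i : ℕ) : ℤ) := by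
    rw [chamberSize, Nat.cast_sum, ← Finset.sum_sub_distrib]
    exact Finset.sum_congr rfl fun i _ => Nat.cast_sub (le_strictMono y i)
  rw [mem_chamberLevel]
  constructor
  · rintro ⟨-, -, h'⟩
    omega
  · intro h'
    exact ⟨fun i => Int.natCast_nonneg _, fun i j hij => Int.ofNat_lt.2 (y.2 hij), by omega⟩

/-- The fibres of `chamberSize` are the levels. -/
def fiberEquivChamberLevel (N n : ℕ) :
    {y : DiscreteChamber N // chamberSize y = n} ≃ chamberLevel N n :=
  Equiv.ofBijective
    (fun y => ⟨fun i => (y.1.1 i : ℤ), (natCast_mem_chamberLevel_iff y.1).2 y.2⟩) <| by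
    constructor
    · intro y y' h
      apply Subtype.ext
      apply Subtype.ext
      funext i
      exact Int.ofNat.inj (congrFun (congrArg Subtype.val h) i)
    · rintro ⟨y, hy⟩
      have h := mem_chamberLevel.1 hy
      lift y to Fin N → ℕ using h.1
      exact ⟨⟨⟨y, fun i j hij => Int.ofNat_lt.1 (h.2.1 hij)⟩,
        (natCast_mem_chamberLevel_iff _).1 hy⟩, rfl⟩

/-- The weight `e^{-∑ x_i} det (1 / (y_i - k)!) det (h_{y_i - k}(x))`. -/
def chamberWeight {N : ℕ} (x : Fin N → ℝ) (y : Fin N → ℤ) : ℝ :=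
  Real.exp (-∑ i, x i) * (shiftDet invFactorial y * shiftDet (homogeneousSumInt x) y)

theorem chamberWeight_nonneg {N : ℕ} {x : Fin N → ℝ} (hx : x ∈ contChamber N)
    (y : DiscreteChamber N) : 0 ≤ chamberWeight x (fun i => (y.1 i : ℤ)) :=
  mul_nonneg (Real.exp_pos _).le
    (mul_nonneg (shiftDet_invFactorial_nonneg y) (shiftDet_homogeneousSumInt_nonneg hx y))

theorem tsum_chamberWeight {N : ℕ} {x : Fin N → ℝ} (hx : x ∈ contChamber N) :
    ∑' y : DiscreteChamber N, ENNReal.ofReal (chamberWeight x (fun i => (y.1 i : ℤ))) = 1 := by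
  have hδ : 0 ≤ ∑ i, x i := Finset.sum_nonneg fun i _ => hx.1 i
  have hlevel : ∀ n : ℕ, ∑' y : {y : DiscreteChamber N // chamberSize y = n},
      ENNReal.ofReal (chamberWeight x (fun i => (y.1.1 i : ℤ))) =
      ENNReal.ofReal (Real.exp (-∑ i, x i) * ((∑ i, x i) ^ n / n.factorial)) := by
    intro n
    refine ((fiberEquivChamberLevel N n).tsum_eq
      fun y => ENNReal.ofReal (chamberWeight x y.1)).trans ?_
    rw [tsum_fintype, Finset.sum_coe_sort (chamberLevel N n) fun y =>
      ENNReal.ofReal (chamberWeight x y), ← ENNReal.ofReal_sum_of_nonneg,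
      ← sum_chamberLevel hx, Finset.mul_sum]
    · rfl
    · intro y hy
      have h := mem_chamberLevel.1 hy
      lift y to Fin N → ℕ using h.1
      exact chamberWeight_nonneg hx ⟨y, fun i j hij => Int.ofNat_lt.1 (h.2.1 hij)⟩
  have hsum := (NormedSpace.expSeries_div_hasSum_exp (∑ i, x i)).mul_left (Real.exp (-∑ i, x i))
  rw [← Real.exp_eq_exp_ℝ, ← Real.exp_add, neg_add_cancel, Real.exp_zero] at hsum
  rw [← (Equiv.sigmaFiberEquiv (chamberSize (N := N))).tsum_eq, ENNReal.tsum_sigma']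
  refine (tsum_congr hlevel).trans ?_
  rw [← ENNReal.ofReal_tsum_of_nonneg (fun n => by positivity) hsum.summable, hsum.tsum_eq,
    ENNReal.ofReal_one]

/-! ### The two kernels -/

theorem smul_mem_contChamber {N : ℕ} {r : ℝ} (hr : 0 ≤ r) {x : Fin N → ℝ}
    (hx : x ∈ contChamber N) : r • x ∈ contChamber N :=
  ⟨fun i => mul_nonneg hr (hx.1 i), fun _ _ hij => mul_le_mul_of_nonneg_left (hx.2 hij) hr⟩

theorem kernelFormula_eq {N : ℕ} {x : Fin N → ℝ} (hx : StrictMono x) (y : DiscreteChamber N) :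
    kernelFormula x y = chamberWeight x (fun i => (y.1 i : ℤ)) := by
  have hv := (vandermonde_pos hx).ne'
  have h1 : (Matrix.of fun i j : Fin N =>
      x i ^ y.1 j * Real.exp (-x i) / ((y.1 j).factorial : ℝ)).det =
      Real.exp (-∑ i, x i) * (∏ j, ((y.1 j).factorial : ℝ))⁻¹ * alternant x y.1 := by
    rw [alternant, ← Matrix.det_transpose, ← Finset.sum_neg_distrib, Real.exp_sum,
      ← Finset.prod_inv_distrib]
    have h2 := Matrix.det_mul_row (fun k => Real.exp (-x k))
      (Matrix.of fun i k : Fin N => ((y.1 i).factorial : ℝ)⁻¹ * x k ^ y.1 i)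
    have h3 := Matrix.det_mul_column (fun i => ((y.1 i).factorial : ℝ)⁻¹)
      (Matrix.of fun i k : Fin N => x k ^ y.1 i)
    simp only [Matrix.of_apply] at h2 h3
    rw [h3] at h2
    rw [mul_assoc, ← h2]
    congr 1
    ext i k
    simp only [Matrix.transpose_apply, Matrix.of_apply]
    ring
  rw [kernelFormula, h1, alternant_eq, chamberWeight, shiftDet_invFactorial]
  field_simp

theorem tendsto_kernelFormula {N : ℕ} (x : Fin N → ℝ) (y : DiscreteChamber N) :
    Tendsto (fun z => kernelFormula z y) (𝓝[contChamberInterior N] x)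
      (𝓝 (chamberWeight x (fun i => (y.1 i : ℤ)))) := by
  have hc : Continuous fun z : Fin N → ℝ => chamberWeight z (fun i => (y.1 i : ℤ)) := by
    refine Continuous.mul (by fun_prop) (continuous_const.mul (continuous_shiftDet _))
  refine (hc.continuousAt.tendsto.mono_left nhdsWithin_le_nhds).congr' ?_
  filter_upwards [self_mem_nhdsWithin] with z hz
  exact (kernelFormula_eq hz.2 y).symm

theorem kernelScaled_eq {N : ℕ} {r : ℝ} (hr : 0 ≤ r) {x : Fin N → ℝ} (hx : x ∈ contChamber N)
    (y : DiscreteChamber N) :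
    kernelScaled r x y = chamberWeight (r • x) (fun i => (y.1 i : ℤ)) :=
  extendFrom_eq (mem_closure_contChamberInterior (smul_mem_contChamber hr hx))
    (tendsto_kernelFormula _ _)

theorem boundaryWeight_eq {N : ℕ} {r : ℝ} (hr : 0 < r) (x : contChamber N) {ν : YoungDiagram}
    (hν : ν ∈ atMostRows N) :
    boundaryWeight r (omegaPoint x) ν = chamberWeight (r • x.1) (chamberVec N ν) := by
  have h1 : homogeneousSumInt (r • x.1) = fun m => r ^ m * homogeneousSumInt x.1 m :=
    funext fun m => homogeneousSumInt_smul x.1 r m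
  have h2 : ∑ i, (r • x.1) i = r * (omegaPoint x).δ := by
    simp [omegaPoint, Finset.mul_sum]
  rw [boundaryWeight, chamberWeight, dim_div_factorial hν, schur_omegaPoint hν, h1,
    shiftDet_zpow_mul hr.ne', sum_chamberVec hν, add_sub_cancel_right, zpow_natCast, h2]
  ring

theorem boundaryWeight_eq_zero {N : ℕ} (r : ℝ) (x : contChamber N) {ν : YoungDiagram}
    (hν : ν ∉ atMostRows N) : boundaryWeight r (omegaPoint x) ν = 0 := by
  rw [boundaryWeight, schur_omegaPoint_eq_zero hν, mul_zero]

theorem boundaryWeight_nonneg {N : ℕ} {r : ℝ} (hr : 0 < r) (x : contChamber N)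
    (ν : YoungDiagram) : 0 ≤ boundaryWeight r (omegaPoint x) ν := by
  by_cases hν : ν ∈ atMostRows N
  · rw [boundaryWeight_eq hr x hν]
    exact chamberWeight_nonneg (smul_mem_contChamber hr.le x.2) (toDiscreteChamber N ν)
  · exact (boundaryWeight_eq_zero r x hν).ge

theorem isProbabilityMeasure_kernelMeasure {N : ℕ} {r : ℝ} (hr : 0 ≤ r) {x : Fin N → ℝ}
    (hx : x ∈ contChamber N) : IsProbabilityMeasure (kernelMeasure r x) := by
  constructor
  rw [kernelMeasure, withDensity_apply _ MeasurableSet.univ, Measure.restrict_univ,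
    lintegral_count]
  simp only [kernelScaled_eq hr hx]
  exact tsum_chamberWeight (smul_mem_contChamber hr hx)

theorem boundaryKernel_compl {N : ℕ} (r : ℝ) (x : contChamber N) :
    boundaryKernel r (omegaPoint x) (atMostRows N)ᶜ = 0 := by
  have hm : MeasurableSet (atMostRows N)ᶜ := MeasurableSpace.measurableSet_top
  rw [boundaryKernel, withDensity_apply _ hm, setLIntegral_congr_fun hm (g := fun _ => 0)]
  · simp
  · intro ν hν
    simp [boundaryWeight_eq_zero r x hν]

theorem map_boundaryKernel {N : ℕ} {r : ℝ} (hr : 0 < r) (x : contChamber N) :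
    Measure.map (chamberEquiv N)
      (Measure.comap Subtype.val (boundaryKernel r (omegaPoint x))) = kernelMeasure r x.1 := by
  have hmt : ∀ s : Set YoungDiagram, MeasurableSet s := fun s => MeasurableSpace.measurableSet_top
  have hms : ∀ s : Set (atMostRows N), MeasurableSet s := fun s =>
    ⟨Subtype.val '' s, hmt _, Set.preimage_image_eq s Subtype.val_injective⟩
  have : MeasurableSingletonClass YoungDiagram := ⟨fun ν => hmt _⟩
  refine Measure.ext_of_singleton fun y => ?_
  obtain ⟨ν, rfl⟩ := (chamberEquiv N).surjective y
  have hpre : chamberEquiv N ⁻¹' {chamberEquiv N ν} = {ν} := by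
    ext μ
    simp
  rw [Measure.map_apply (fun _ _ => hms _) (measurableSet_singleton _), hpre,
    Measure.comap_apply _ Subtype.val_injective (fun s _ => hmt _) _ (hms _),
    Set.image_singleton, boundaryKernel, kernelMeasure, withDensity_apply _ (hmt _),
    withDensity_apply _ (measurableSet_singleton _), lintegral_singleton, lintegral_singleton,
    Measure.count_singleton, Measure.count_singleton, boundaryWeight_eq hr x ν.2,
    kernelScaled_eq hr.le x.2]
  rfl

theorem isProbabilityMeasure_boundaryKernel {N : ℕ} {r : ℝ} (hr : 0 < r) (x : contChamber N) :
    IsProbabilityMeasure (boundaryKernel r (omegaPoint x)) := by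
  have hmt : ∀ s : Set YoungDiagram, MeasurableSet s := fun s => MeasurableSpace.measurableSet_top
  have hms : ∀ s : Set (atMostRows N), MeasurableSet s := fun s =>
    ⟨Subtype.val '' s, hmt _, Set.preimage_image_eq s Subtype.val_injective⟩
  constructor
  have h := (isProbabilityMeasure_kernelMeasure hr.le x.2).measure_univ
  rw [← map_boundaryKernel hr x, Measure.map_apply (fun _ _ => hms _) MeasurableSet.univ,
    Set.preimage_univ, Measure.comap_apply _ Subtype.val_injective (fun s _ => hmt _) _ (hms _),
    Set.image_univ, Subtype.range_coe] at h
  rw [← measure_add_measure_compl (hmt (atMostRows N)), h, boundaryKernel_compl, add_zero]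

end YoungBouquet

end

theorem mainTheorem8 (N : ℕ) (r : ℝ) (hr : 0 < r) (x : YoungBouquet.contChamber N) :
    -- the continuous extension defining `Λ_{N,r}(x, ·)` exists at `x`
    (∀ y : YoungBouquet.DiscreteChamber N,
      Filter.Tendsto (fun z : Fin N → ℝ => YoungBouquet.kernelFormula z y)
        (nhdsWithin (r • x.1) (YoungBouquet.contChamberInterior N))
        (nhds (YoungBouquet.kernelScaled r x.1 y))) ∧
    -- both sides are genuine probability measures
    (∀ ν : YoungDiagram, 0 ≤ YoungBouquet.boundaryWeight r (YoungBouquet.omegaPoint x) ν) ∧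
    MeasureTheory.IsProbabilityMeasure
      (YoungBouquet.boundaryKernel r (YoungBouquet.omegaPoint x)) ∧
    (∀ y : YoungBouquet.DiscreteChamber N, 0 ≤ YoungBouquet.kernelScaled r x.1 y) ∧
    MeasureTheory.IsProbabilityMeasure (YoungBouquet.kernelMeasure r x.1) ∧
    -- the boundary kernel is supported on the diagrams with at most `N` rows
    YoungBouquet.boundaryKernel r (YoungBouquet.omegaPoint x) (YoungBouquet.atMostRows N)ᶜ = 0 ∧
    -- the two measures coincide under the bijection
    MeasureTheory.Measure.map (YoungBouquet.chamberEquiv N)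
        (MeasureTheory.Measure.comap Subtype.val
          (YoungBouquet.boundaryKernel r (YoungBouquet.omegaPoint x))) =
      YoungBouquet.kernelMeasure r x.1 :=
  ⟨fun y => by
    rw [YoungBouquet.kernelScaled_eq hr.le x.2]
    exact YoungBouquet.tendsto_kernelFormula _ y,
  YoungBouquet.boundaryWeight_nonneg hr x,
  YoungBouquet.isProbabilityMeasure_boundaryKernel hr x,
  fun y => by
    rw [YoungBouquet.kernelScaled_eq hr.le x.2]
    exact YoungBouquet.chamberWeight_nonneg (YoungBouquet.smul_mem_contChamber hr.le x.2) y,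
  YoungBouquet.isProbabilityMeasure_kernelMeasure hr.le x.2,
  YoungBouquet.boundaryKernel_compl r x,
  YoungBouquet.map_boundaryKernel hr x⟩
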